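/- Let $n\ge 1$, let $z_1,\dots,z_n$ be points of the open unit disk (not necessarily distinct), let $\alpha\in\mathbb{R}$, and let $$B(z)=e^{i\alpha}\prod_{k=1}^{n}\frac{z_k-z}{1-\overline{z_k}\,z}$$ be the corresponding finite Blaschke product of order $n$. Let $\mathbb{T}$ be the unit circle and let $G_B$ be the set of all continuous maps $u:\mathbb{T}\to\mathbb{T}$ such that $B\circ u=B$ on $\mathbb{T}$. Then $G_B$, with composition of maps as its operation, is a cyclic group of order $n$. -/

import Mathlib

/-- `B` is a finite Blaschke product of order `n`: there are a real `α` and `n` points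
`z₁, …, zₙ` of the open unit disk (repetitions allowed) such that
`B w = e^{iα} ∏ₖ (zₖ - w) / (1 - conj zₖ * w)`. -/
def IsFiniteBlaschkeProduct (n : ℕ) (B : ℂ → ℂ) : Prop :=
  ∃ (α : ℝ) (z : Fin n → ℂ), (∀ k, ‖z k‖ < 1) ∧
    ∀ w : ℂ, B w = Complex.exp (Complex.I * (α : ℂ)) *
      ∏ k, (z k - w) / (1 - (starRingEnd ℂ) (z k) * w)

/-- The semigroup (with identity) of all continuous maps `u : 𝕋 → 𝕋` of the unit circle with
`B ∘ u = B` on `𝕋`. The multiplication of `Function.End Circle` is composition of maps. -/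
def blaschkeInvariantMaps (B : ℂ → ℂ) : Submonoid (Function.End Circle) where
  carrier := {u : Circle → Circle | Continuous u ∧ ∀ ζ : Circle, B (u ζ : ℂ) = B (ζ : ℂ)}
  one_mem' := ⟨continuous_id, fun _ => rfl⟩
  mul_mem' := fun {_ v} hu hv =>
    ⟨hu.1.comp hv.1, fun ζ => (hu.2 (v ζ)).trans (hv.2 ζ)⟩

/-!
On the unit circle a factor `w = 1 - conj z * ζ` has positive real part, and
`(z - ζ) / (1 - conj z * ζ) = -ζ * conj w / w`. Hence on `ζ = exp (iθ)` the factor equals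
`exp (i p(θ))` with `p(θ) = θ + π - 2 arg w`, a continuous real function (`blaschkePhase`) that
satisfies `p(θ + 2π) = p(θ) + 2π`. As the factor is injective on the circle, `p` is injective, hence
strictly increasing. Averaging the phases of the `n` factors gives a strictly increasing continuous
`ψ` with `ψ(θ + 2π) = ψ(θ) + 2π`, that is, the lift of a homeomorphism `H` of the circle
(`exists_homeomorph_circle_of_lift`), and `B = H ^ n` on the circle
(`exists_homeomorph_pow_eq_blaschke`).

Conjugating by `H` reduces the problem to the power map: `B ∘ u = B` holds if and only if `H ∘ u`
and `H` have the same `n`-th power. For continuous `u` the quotient `(H ∘ u) / H` is then a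
continuous map from the connected circle to the finite set of `n`-th roots of unity, so it is
constant. The invariant maps are therefore exactly the maps `H⁻¹ ∘ (ω * ·) ∘ H` with `ω ^ n = 1`,
and they form a group isomorphic to the group of `n`-th roots of unity
(`rootsOfUnityEquivInvariantMaps`).
-/

open ComplexConjugate

/-! ### The phase of a Blaschke factor on the circle -/

lemma one_sub_conj_mul_mem_slitPlane {z : ℂ} (hz : ‖z‖ < 1) (ζ : Circle) :
    1 - conj z * (ζ : ℂ) ∈ Complex.slitPlane := by
  refine Or.inl ?_
  have h : (conj z * (ζ : ℂ)).re ≤ ‖conj z * (ζ : ℂ)‖ := Complex.re_le_norm _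
  rw [norm_mul, Circle.norm_coe, mul_one, RCLike.norm_conj] at h
  rw [Complex.sub_re, Complex.one_re]
  linarith

/-- The argument, as a function of `θ`, of the Blaschke factor with zero `z` at the point
`exp (iθ)` of the circle. The principal branch `Complex.arg` makes it continuous, because
`1 - conj z * exp (iθ)` stays in the right half-plane when `‖z‖ < 1`. -/
noncomputable def blaschkePhase (z : ℂ) (θ : ℝ) : ℝ :=
  θ + Real.pi - 2 * Complex.arg (1 - conj z * (Circle.exp θ : ℂ))

lemma Complex.mul_exp_neg_two_arg (w : ℂ) :
    w * Complex.exp (-(2 * (w.arg : ℂ)) * Complex.I) = conj w := by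
  have h := Complex.norm_mul_exp_arg_mul_I w
  have hc : conj w = ‖w‖ * Complex.exp (-(w.arg : ℂ) * Complex.I) := by
    conv_lhs => rw [← h]
    rw [map_mul, Complex.conj_ofReal, ← Complex.exp_conj]
    simp
  calc w * Complex.exp (-(2 * (w.arg : ℂ)) * Complex.I)
      = ‖w‖ * Complex.exp (w.arg * Complex.I) *
          Complex.exp (-(2 * (w.arg : ℂ)) * Complex.I) := by rw [h]
    _ = conj w := by
      rw [hc, mul_assoc, ← Complex.exp_add]
      congr 2
      ring

lemma exp_blaschkePhase {z : ℂ} (hz : ‖z‖ < 1) (θ : ℝ) :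
    (Circle.exp (blaschkePhase z θ) : ℂ) =
      (z - Circle.exp θ) / (1 - conj z * (Circle.exp θ : ℂ)) := by
  have hw := Complex.slitPlane_ne_zero (one_sub_conj_mul_mem_slitPlane hz (Circle.exp θ))
  rw [eq_div_iff hw, blaschkePhase, Circle.coe_exp]
  have key := Complex.mul_exp_neg_two_arg (1 - conj z * (Circle.exp θ : ℂ))
  generalize hd : Complex.arg (1 - conj z * (Circle.exp θ : ℂ)) = a at *
  have hexp : Complex.exp (((θ + Real.pi - 2 * a : ℝ) : ℂ) * Complex.I) =
      -(Circle.exp θ : ℂ) * Complex.exp (-(2 * (a : ℂ)) * Complex.I) := by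
    rw [Circle.coe_exp, ← neg_one_mul, ← Complex.exp_pi_mul_I, ← Complex.exp_add,
      ← Complex.exp_add]
    congr 1
    push_cast
    ring
  have hunit : (Circle.exp θ : ℂ) * conj (Circle.exp θ : ℂ) = 1 := by
    rw [Complex.mul_conj, Circle.normSq_coe, Complex.ofReal_one]
  rw [hexp, mul_assoc, mul_comm (Complex.exp _), key]
  simp only [map_sub, map_one, map_mul, Complex.conj_conj]
  linear_combination z * hunit

lemma continuous_blaschkePhase {z : ℂ} (hz : ‖z‖ < 1) : Continuous (blaschkePhase z) := by
  have h : Continuous fun θ : ℝ => Complex.arg (1 - conj z * (Circle.exp θ : ℂ)) := by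
    refine continuous_iff_continuousAt.2 fun θ => ?_
    refine (Complex.continuousAt_arg (one_sub_conj_mul_mem_slitPlane hz _)).comp
      (f := fun θ : ℝ => 1 - conj z * (Circle.exp θ : ℂ)) ?_
    fun_prop
  unfold blaschkePhase
  fun_prop

lemma blaschkePhase_add_two_pi (z : ℂ) (θ : ℝ) :
    blaschkePhase z (θ + 2 * Real.pi) = blaschkePhase z θ + 2 * Real.pi := by
  simp only [blaschkePhase, Circle.exp_add_two_pi]
  ring

lemma blaschkePhase_injective {z : ℂ} (hz : ‖z‖ < 1) : Function.Injective (blaschkePhase z) := by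
  intro s t hst
  have hs := exp_blaschkePhase hz s
  rw [hst, exp_blaschkePhase hz t,
    div_eq_div_iff (Complex.slitPlane_ne_zero (one_sub_conj_mul_mem_slitPlane hz _))
      (Complex.slitPlane_ne_zero (one_sub_conj_mul_mem_slitPlane hz _))] at hs
  have hne : (1 : ℂ) - z * conj z ≠ 0 := by
    rw [Complex.mul_conj, Complex.normSq_eq_norm_sq]
    have : (1 : ℝ) - ‖z‖ ^ 2 ≠ 0 := by nlinarith [norm_nonneg z]
    exact_mod_cast this
  have hexp : Circle.exp s = Circle.exp t := by
    refine Circle.ext (mul_left_cancel₀ hne ?_)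
    linear_combination hs
  -- Equal points on the circle have equal `arg` terms, so only the linear terms are left.
  unfold blaschkePhase at hst
  rw [hexp] at hst
  linarith

lemma strictMono_blaschkePhase {z : ℂ} (hz : ‖z‖ < 1) : StrictMono (blaschkePhase z) := by
  refine ((continuous_blaschkePhase hz).strictMono_of_inj
    (blaschkePhase_injective hz)).resolve_right fun h => ?_
  have := h (show (0 : ℝ) < 0 + 2 * Real.pi by linarith [Real.pi_pos])
  rw [blaschkePhase_add_two_pi] at this
  linarith [Real.pi_pos]

/-! ### Homeomorphisms of the circle from their lifts -/

lemma exists_homeomorph_circle_of_lift {ψ : ℝ → ℝ} (hc : Continuous ψ) (hm : StrictMono ψ)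
    (hp : ∀ θ, ψ (θ + 2 * Real.pi) = ψ θ + 2 * Real.pi) :
    ∃ H : Circle ≃ₜ Circle, ∀ θ, H (Circle.exp θ) = Circle.exp (ψ θ) := by
  have hint : ∀ (m : ℤ) (θ : ℝ), ψ (θ + m * (2 * Real.pi)) = ψ θ + m * (2 * Real.pi) := by
    intro m θ
    have hper : Function.Periodic (fun θ => ψ θ - θ) (2 * Real.pi) := fun θ => by
      simp only [hp]
      ring
    have := hper.int_mul m θ
    linarith
  -- `arg` jumps at `-1`, but `arg (exp θ) - θ` is a multiple of `2π`, which `exp ∘ ψ` ignores.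
  have hlift : ∀ θ, Circle.exp (ψ (Complex.arg (Circle.exp θ))) = Circle.exp (ψ θ) := by
    intro θ
    obtain ⟨m, hm'⟩ := Circle.exp_eq_exp.1 (Circle.exp_arg (Circle.exp θ))
    rw [hm', hint]
    exact Circle.exp_eq_exp.2 ⟨m, rfl⟩
  have hsurj : Function.Surjective ψ := by
    intro y
    have hpi := Real.two_pi_pos
    refine mem_range_of_exists_le_of_exists_ge hc ?_ ?_
    · refine ⟨0 + (⌊(y - ψ 0) / (2 * Real.pi)⌋ : ℤ) * (2 * Real.pi), ?_⟩
      rw [hint]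
      have := (le_div_iff₀ hpi).1 (Int.floor_le ((y - ψ 0) / (2 * Real.pi)))
      linarith
    · refine ⟨0 + (⌈(y - ψ 0) / (2 * Real.pi)⌉ : ℤ) * (2 * Real.pi), ?_⟩
      rw [hint]
      have := (div_le_iff₀ hpi).1 (Int.le_ceil ((y - ψ 0) / (2 * Real.pi)))
      linarith
  let h : Circle → Circle := fun ζ => Circle.exp (ψ (Complex.arg ζ))
  have hcont : Continuous h := by
    have hq : Topology.IsQuotientMap Circle.exp :=
      isLocalHomeomorph_circleExp.isOpenMap.isQuotientMap Circle.exp.continuous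
        Circle.exp_surjective
    rw [hq.continuous_iff]
    have : h ∘ Circle.exp = Circle.exp ∘ ψ := funext hlift
    rw [this]
    exact Circle.exp.continuous.comp hc
  have hbij : Function.Bijective h := by
    constructor
    · intro ξ ζ hξζ
      obtain ⟨m, hm'⟩ := Circle.exp_eq_exp.1 hξζ
      rw [← hint] at hm'
      rw [← Circle.exp_arg ξ, ← Circle.exp_arg ζ]
      exact Circle.exp_eq_exp.2 ⟨m, hm.injective hm'⟩
    · intro ζ
      obtain ⟨θ, hθ⟩ := hsurj (Complex.arg ζ)
      refine ⟨Circle.exp θ, ?_⟩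
      change Circle.exp _ = _
      rw [hlift, hθ, Circle.exp_arg]
  exact ⟨Continuous.homeoOfEquivCompactToT2 (f := Equiv.ofBijective h hbij) hcont, hlift⟩

lemma exists_homeomorph_pow_eq_blaschke {n : ℕ} (hn : n ≠ 0) {B : ℂ → ℂ}
    (hB : IsFiniteBlaschkeProduct n B) :
    ∃ H : Circle ≃ₜ Circle, ∀ ζ : Circle, B ζ = ((H ζ ^ n : Circle) : ℂ) := by
  obtain ⟨α, z, hz, hBz⟩ := hB
  have hn' : (0 : ℝ) < n := by exact_mod_cast Nat.pos_of_ne_zero hn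
  have : Nonempty (Fin n) := ⟨⟨0, Nat.pos_of_ne_zero hn⟩⟩
  let ψ : ℝ → ℝ := fun θ => (α + ∑ k, blaschkePhase (z k) θ) / n
  obtain ⟨H, hH⟩ := exists_homeomorph_circle_of_lift (ψ := ψ)
    ((continuous_const.add
      (continuous_finsetSum _ fun k _ => continuous_blaschkePhase (hz k))).div_const _)
    (fun s t hst => by
      have : ∑ k, blaschkePhase (z k) s < ∑ k, blaschkePhase (z k) t :=
        Finset.sum_lt_sum_of_nonempty Finset.univ_nonempty
          fun k _ => strictMono_blaschkePhase (hz k) hst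
      simp only [ψ]
      gcongr)
    (fun θ => by
      simp only [ψ, blaschkePhase_add_two_pi, Finset.sum_add_distrib, Finset.sum_const,
        Finset.card_univ, Fintype.card_fin, nsmul_eq_mul]
      field_simp
      ring)
  refine ⟨H, fun ζ => ?_⟩
  obtain ⟨θ, rfl⟩ := Circle.exp_surjective ζ
  rw [hBz, hH, Circle.coe_pow, Circle.coe_exp (ψ θ), ← Complex.exp_nat_mul]
  have hsum : (n : ℂ) * ((ψ θ : ℂ) * Complex.I) =
      Complex.I * α + ∑ k, (blaschkePhase (z k) θ : ℂ) * Complex.I := by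
    have : (n : ℝ) * ψ θ = α + ∑ k, blaschkePhase (z k) θ := by
      simp only [ψ]
      field_simp
    rw [← mul_assoc, ← Finset.sum_mul]
    have h2 : (n : ℂ) * (ψ θ : ℂ) = α + ∑ k, (blaschkePhase (z k) θ : ℂ) := by exact_mod_cast this
    rw [h2]
    ring
  rw [hsum, Complex.exp_add, Complex.exp_sum]
  congr 1
  refine Finset.prod_congr rfl fun k _ => ?_
  rw [← Circle.coe_exp (blaschkePhase (z k) θ), exp_blaschkePhase (hz k)]

/-! ### Invariant maps and roots of unity -/

lemma exists_div_eq_const_of_pow_eq {n : ℕ} (hn : n ≠ 0) {f g : Circle → Circle}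
    (hf : Continuous f) (hg : Continuous g) (h : ∀ ζ, f ζ ^ n = g ζ ^ n) :
    ∃ ω : Circle, ω ^ n = 1 ∧ ∀ ζ, f ζ = ω * g ζ := by
  have : NeZero n := ⟨hn⟩
  have hfin : {ω : Circle | ω ^ n = 1}.Finite := by
    refine (Set.finite_range fun ω : rootsOfUnity n Circle => ((ω : Circleˣ) : Circle)).subset ?_
    intro ω hω
    exact ⟨rootsOfUnity.mkOfPowEq ω hω, rfl⟩
  have hpow : ∀ ζ, (f ζ / g ζ) ^ n = 1 := fun ζ => by rw [div_pow, h, div_self']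
  have hsub : (Set.range fun ζ => f ζ / g ζ).Subsingleton :=
    hfin.countable.isTotallyDisconnected _ (Set.range_subset_iff.2 hpow)
      (isPreconnected_range (hf.div' hg))
  refine ⟨f 1 / g 1, hpow 1, fun ζ => ?_⟩
  rw [hsub (Set.mem_range_self (f := fun ζ => f ζ / g ζ) 1) (Set.mem_range_self ζ), div_mul_cancel]

/-- If `B = H ^ n` on the circle for a homeomorphism `H`, the `n`-th root of unity `ω` corresponds
to the invariant map `H⁻¹ ∘ (ω * ·) ∘ H`. -/
noncomputable def rootsOfUnityEquivInvariantMaps {n : ℕ} (hn : n ≠ 0) {B : ℂ → ℂ}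
    (H : Circle ≃ₜ Circle) (hH : ∀ ζ : Circle, B ζ = ((H ζ ^ n : Circle) : ℂ)) :
    rootsOfUnity n Circle ≃* blaschkeInvariantMaps B :=
  MulEquiv.ofBijective
    ({ toFun := fun ω => ⟨fun ζ => H.symm (((ω : Circleˣ) : Circle) * H ζ), by
          refine ⟨by fun_prop, fun ζ => ?_⟩
          have hω : ((ω : Circleˣ) : Circle) ^ n = 1 := by
            rw [← Units.val_pow_eq_pow_val, (mem_rootsOfUnity n _).1 ω.2, Units.val_one]
          rw [hH, hH, H.apply_symm_apply, mul_pow, hω, one_mul]⟩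
       map_one' := Subtype.ext (funext fun ζ => by simp; rfl)
       map_mul' := fun ω η => Subtype.ext (funext fun ζ => by
          change _ = H.symm (_ * H (H.symm _))
          rw [H.apply_symm_apply, ← mul_assoc]
          rfl) } : rootsOfUnity n Circle →* blaschkeInvariantMaps B)
    (by
      constructor
      · intro ω η h
        have h1 := H.symm.injective (congrFun (congrArg Subtype.val h) 1)
        exact Subtype.ext (Units.ext (mul_right_cancel h1))
      · rintro ⟨u, hu, hBu⟩
        obtain ⟨ω, hω, hω'⟩ := exists_div_eq_const_of_pow_eq hn
          (f := fun ζ => H (u ζ)) (g := H) (H.continuous.comp hu) H.continuous fun ζ => by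
            have := hBu ζ
            rw [hH, hH] at this
            exact Circle.ext this
        have : NeZero n := ⟨hn⟩
        refine ⟨rootsOfUnity.mkOfPowEq ω hω, Subtype.ext (funext fun ζ => ?_)⟩
        change H.symm (ω * H ζ) = u ζ
        rw [← hω', H.symm_apply_apply])

theorem theoremT (n : ℕ) (hn : 1 ≤ n) (B : ℂ → ℂ) (hB : IsFiniteBlaschkeProduct n B) :
    ∃ G : Group (blaschkeInvariantMaps B),
      G.toMonoid = Submonoid.toMonoid (blaschkeInvariantMaps B) ∧
        IsCyclic (blaschkeInvariantMaps B) ∧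
        Nat.card (blaschkeInvariantMaps B) = n := by
  have hn0 : n ≠ 0 := Nat.one_le_iff_ne_zero.1 hn
  have : NeZero n := ⟨hn0⟩
  obtain ⟨H, hH⟩ := exists_homeomorph_pow_eq_blaschke hn0 hB
  let e := rootsOfUnityEquivInvariantMaps hn0 H hH
  let G : Group (blaschkeInvariantMaps B) :=
    { Submonoid.toMonoid (blaschkeInvariantMaps B) with
      inv := fun u => e (e.symm u)⁻¹
      inv_mul_cancel := fun u => e.symm.injective (by
        change e.symm (e (e.symm u)⁻¹ * u) = e.symm 1
        rw [map_mul, e.symm_apply_apply, inv_mul_cancel, map_one]) }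
  refine ⟨G, rfl, ?_, ?_⟩
  · exact isCyclic_of_surjective (e : rootsOfUnity n Circle →* blaschkeInvariantMaps B) e.surjective
  · rw [← Nat.card_congr e.toEquiv, Nat.card_congr (rootsOfUnityCircleEquiv n).toEquiv,
      Complex.card_rootsOfUnity]
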